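/- **Setting.** Let $\mathcal X$ be a Polish space with its Borel $\sigma$-algebra, $\mathcal U$ a compact metrizable space of controls (e.g. a compact subset of $\mathbb R^p$), and $\mathrm{AP}$ a finite set of atomic propositions. A controlled Markov system $\mathbb{XU}=(\mathcal X,\mathcal U,\{\mathcal T\},\mathrm{AP},L_{\mathbb{XU}})$ consists of a nonempty collection $[\![\mathcal T^u]\!]$ of transition probabilities (Markov kernels) on $\mathcal X$ for each $u\in\mathcal U$ and a measurable labelling $L_{\mathbb{XU}}:\mathcal X\to 2^{\mathrm{AP}}$. A deterministic admissible policy $\phi$ is a sequence of measurable maps giving the control $\mathfrak u_t=\phi_t(X_{[0,t]},\mathfrak u_{[0,t-1]})$. For an initial distribution $\nu_0$, the set $\mathbb{XU}^\phi$ consists of all processes $(X_t,\mathfrak u_t)_{t\ge0}$ such that $X_0\sim\nu_0$, a.s. $\mathfrak u_t=\phi_t(X_{[0,t]},\mathfrak u_{[0,t-1]})$ for all $t$, and for every $t$, a.s., the conditional law of $X_{t+1}$ given $(X_{[0,t]},\mathfrak u_{[0,t]})$ is $\mathcal T(X_t,\cdot)$ for some $\mathcal T\in[\![\mathcal T^{\mathfrak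 u_t}]\!]$, whose choice may depend on $t$ and on that history. For an $\omega$-regular $\Psi\subseteq(2^{\mathrm{AP}})^\omega$ (the language of a finite nondeterministic Büchi automaton), $\rho\in[0,1]$ and ${\bowtie}\in\{\le,<,\ge,>\}$, write $X^\phi\vDash\mathbf P^{\nu_0,\phi}_{\bowtie\rho}[\Psi]$ if the probability that $L_{\mathbb{XU}}(X_0)L_{\mathbb{XU}}(X_1)\cdots\in\Psi$ is $\bowtie\rho$. A BMDP has a finite state set $\mathcal Q$, a finite action set $\mathit{Act}$, a labelling $L_{\mathbb{IA}}:\mathcal Q\to2^{\mathrm{AP}}$ and real matrices $\check\Theta^a,\hat\Theta^a$ indexed by $\mathcal Q\times\mathcal Q$ for each $a\in\mathit{Act}$. It induces the controlled Markov system $\mathbb{IA}$ on $\mathcal Q$ in which $[\![\Theta^a]\!]$ is the set of all stochastic matrices $\Theta$ with $\check\Theta^a\le\Theta\le\hat\Theta^a$ entrywise; its policies and processes are defined as above, and those started at $q_0\in\mathcal Q$ have initial law $\delta_{q_0}$. We call $\mathbb{IA}$ a BMDP abstraction of $\mathbb{XU}$ if there are a relation $\alpha\subseteq\mathcal X\times\mathcal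 Q$ and a relation $\Sigma_\alpha$ between probability measures on $\mathcal X$ and on $\mathcal Q$ such that 1. the sets $\alpha^{-1}(q)=\{x:(x,q)\in\alpha\}$, $q\in\mathcal Q$, are measurable and each $x\in\mathcal X$ lies in exactly one of them; and for all $x$ there is $q$ with $(x,q)\in\alpha$ and $L_{\mathbb{IA}}(q)=L_{\mathbb{XU}}(x)$; 2. for all $q\in\mathcal Q$ and $a\in\mathit{Act}$ there is $u\in\mathcal U$ such that for every $\mathcal T\in[\![\mathcal T^u]\!]$ and every $x\in\alpha^{-1}(q)$ there is $\Theta\in[\![\Theta^a]\!]$ with $(\mathcal T(x,\cdot),\Theta_{q})\in\Sigma_\alpha$ and $\mathcal T(x,\alpha^{-1}(q'))=\Theta_{qq'}$ for all $q'\in\mathcal Q$. **Statement.** Let $\mathbb{IA}$ be a BMDP abstraction of $\mathbb{XU}$ through $\alpha,\Sigma_\alpha$, let $\Psi$ be $\omega$-regular, $\rho\in[0,1]$, ${\bowtie}\in\{\le,<,\ge,>\}$ and $q_0\in\mathcal Q$. Suppose there is a deterministic admissible policy $\kappa$ of $\mathbb{IA}$ such that $I^\kappa\vDash\mathcal P^{q_0,\kappa}_{\bowtie\rho}[\Psi]$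 for every process $I^\kappa\in\mathbb{IA}^\kappa$ started at $q_0$. Then there is a deterministic admissible policy $\phi$ of $\mathbb{XU}$ such that, for every initial distribution $\nu_0$ with $\nu_0(\alpha^{-1}(q_0))=1$, there is at least one process $X^\phi\in\mathbb{XU}^\phi$ with initial law $\nu_0$, and every such process satisfies $X^\phi\vDash\mathbf P^{\nu_0,\phi}_{\bowtie\rho}[\Psi]$. -/

import Mathlib

open MeasureTheory ProbabilityTheory

/-- A transition probability on `X`, i.e. a Markov kernel. On a finite discrete space this is a
stochastic matrix. -/
abbrev TransitionProb (X : Type*) [MeasurableSpace X] :=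
  {T : Kernel X X // IsMarkovKernel T}

/-- The measure `T(x, ·)`; for a stochastic matrix, its row with index `x`. -/
def TransitionProb.row {X : Type*} [MeasurableSpace X] (T : TransitionProb X) (x : X) :
    ProbabilityMeasure X :=
  ⟨T.1 x, T.2.isProbabilityMeasure x⟩

/-- A (labelled) controlled Markov system with state space `X`, control space `U` and atomic
propositions `AP`: every control value `u` comes with a collection of transition probabilities,
and states are labelled measurably by subsets of `AP`. -/
structure ControlledMarkovSystem (X U AP : Type*) [MeasurableSpace X] where
  /-- The collection of the transition probabilities that are possible under the control `u`. -/
  trans : U → Set (TransitionProb X)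
  label : X → Set AP
  measurable_label : Measurable label

/-- A deterministic admissible control policy: the control value at time `t` is a measurable
function of the states at the times `0, …, t` and the control values at the times
`0, …, t - 1`. -/
structure ControlPolicy (X U : Type*) [MeasurableSpace X] [MeasurableSpace U] where
  rule : (t : ℕ) → (Fin (t + 1) → X) × (Fin t → U) → U
  measurable_rule : ∀ t, Measurable (rule t)

namespace ControlledMarkovSystem

variable {X U AP : Type*} [MeasurableSpace X] [MeasurableSpace U]

/-- The processes that the system generates under the policy `φ` from the initial distribution
`ν₀`, given by the joint law `P` of states and controls on the canonical space `(X × U)^∞`: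
the initial state has law `ν₀`, the controls follow `φ`, and at each time `t`, given the history
up to time `t`, the next state is distributed according to a transition probability that is chosen
(possibly in dependence on that history) from the collection of the current control value. -/
def laws [StandardBorelSpace X] [Nonempty X] (S : ControlledMarkovSystem X U AP)
    (φ : ControlPolicy X U) (ν₀ : ProbabilityMeasure X) :
    Set (ProbabilityMeasure (ℕ → X × U)) :=
  {P | (P : Measure (ℕ → X × U)).map (fun ω => (ω 0).1) = (ν₀ : Measure X) ∧
    (∀ t : ℕ, ∀ᵐ ω ∂(P : Measure (ℕ → X × U)),
      (ω t).2 = φ.rule t (fun i => (ω i).1, fun i => (ω i).2)) ∧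
    (∀ t : ℕ, ∀ᵐ ω ∂(P : Measure (ℕ → X × U)), ∃ T ∈ S.trans (ω t).2,
      condDistrib (fun ω' : ℕ → X × U => (ω' (t + 1)).1)
        (fun (ω' : ℕ → X × U) (i : Fin (t + 1)) => ω' i) (P : Measure (ℕ → X × U))
        (fun i : Fin (t + 1) => ω i) = T.1 (ω t).1)}

/-- The event that the trace of the controlled path belongs to the linear-time property `Ψ`. -/
def satEvent (S : ControlledMarkovSystem X U AP) (Ψ : Set (ℕ → Set AP)) :
    Set (ℕ → X × U) :=
  {ω | (fun t => S.label (ω t).1) ∈ Ψ}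

end ControlledMarkovSystem

/-- The comparison signs `≤`, `<`, `≥`, `>`. -/
inductive Comparison
  | le
  | lt
  | ge
  | gt

/-- `c.holds p ρ` means `p ⋈ ρ`. -/
def Comparison.holds : Comparison → ℝ → ℝ → Prop
  | .le, p, ρ => p ≤ ρ
  | .lt, p, ρ => p < ρ
  | .ge, p, ρ => p ≥ ρ
  | .gt, p, ρ => p > ρ

/-- The process with joint law `P` satisfies the probabilistic specification `P_{⋈ρ}[Ψ]`. -/
def ControlledMarkovSystem.Satisfies {X U AP : Type*} [MeasurableSpace X] [MeasurableSpace U]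
    (S : ControlledMarkovSystem X U AP) (P : ProbabilityMeasure (ℕ → X × U))
    (c : Comparison) (ρ : ℝ) (Ψ : Set (ℕ → Set AP)) : Prop :=
  c.holds ((P : Measure (ℕ → X × U)).real (S.satEvent Ψ)) ρ

/-- `Ψ` is an ω-regular set of infinite words: it is the language of a nondeterministic Büchi
automaton with finitely many states. -/
def IsOmegaRegular {A : Type*} (Ψ : Set (ℕ → A)) : Prop :=
  ∃ (m : ℕ) (init : Set (Fin m)) (step : Fin m → A → Set (Fin m)) (acc : Set (Fin m)),
    Ψ = {w | ∃ r : ℕ → Fin m, r 0 ∈ init ∧ (∀ t, r (t + 1) ∈ step (r t) (w t)) ∧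
      ∀ n, ∃ t, n ≤ t ∧ r t ∈ acc}

/-- A bounded-parameter Markov decision process with finite state space `Q` and finite action
space `Act`: entrywise lower and upper bounds for the transition matrices of each action. -/
structure BMDP (Q Act AP : Type*) where
  lower : Act → Matrix Q Q ℝ
  upper : Act → Matrix Q Q ℝ
  label : Q → Set AP

/-- The controlled Markov system induced by a BMDP: the collection of an action consists of all
stochastic matrices that lie entrywise between the bounds. -/
def BMDP.toSystem {Q Act AP : Type*} [MeasurableSpace Q] [DiscreteMeasurableSpace Q]
    (B : BMDP Q Act AP) : ControlledMarkovSystem Q Act AP where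
  trans a := {Θ | ∀ i j, B.lower a i j ≤ (Θ.1 i).real {j} ∧ (Θ.1 i).real {j} ≤ B.upper a i j}
  label := B.label
  measurable_label := Measurable.of_discrete

/-- The set `α⁻¹(q)` of the states that are related to `q`. -/
def relPreimage {X Q : Type*} (α : Set (X × Q)) (q : Q) : Set X :=
  {x | (x, q) ∈ α}

/-- The relation `α` comes from a partition of `X` into measurable cells `α⁻¹(q)`. -/
def IsMeasurablePartition {X Q : Type*} [MeasurableSpace X] (α : Set (X × Q)) : Prop :=
  (∀ x, ∃! q, (x, q) ∈ α) ∧ ∀ q, MeasurableSet (relPreimage α q)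

/-- `IA` abstracts `XU` through the state-level relation `α` and the measure-level relation `R`. -/
structure Abstracts {X U Q Act AP : Type*} [MeasurableSpace X] [MeasurableSpace Q]
    (XU : ControlledMarkovSystem X U AP) (IA : ControlledMarkovSystem Q Act AP)
    (α : Set (X × Q)) (R : Set (ProbabilityMeasure X × ProbabilityMeasure Q)) : Prop where
  state_level : ∀ x, ∃ q, (x, q) ∈ α ∧ IA.label q = XU.label x
  measure_level : ∀ (q : Q) (a : Act), ∃ u : U, ∀ T ∈ XU.trans u, ∀ x ∈ relPreimage α q,
    ∃ Θ ∈ IA.trans a, (T.row x, Θ.row q) ∈ R ∧ ∀ q', T.1 x (relPreimage α q') = Θ.1 q {q'}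

/-! The policy `φ` reads off the cells of the concrete states, computes the action that `κ` would
take on them, and plays a control that refines this action in the current cell
(`ControlPolicy.refine`). Any process under `φ` is pushed forward to the path of its cells and
recomputed actions, and this image is a process of the BMDP under `κ` started at `q₀`
(`map_abstractPath_mem_laws`). Indeed, the conditional law of the next cell given the abstract
history is an average, over the concrete histories behind it, of rows within the bounds, and
interval bounds survive averaging (`condDistrib_comp_real_mem_Icc`). Labels agree along the two
paths, so both processes give `Ψ` the same probability, which settles all four comparisons at once.
Comparing these probabilities uses that `Ψ` is Borel (`IsOmegaRegular.measurableSet`). Existence of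
a process is an Ionescu-Tulcea construction (`ControlPolicy.exists_law`). -/

/-! ### Borel measurability of ω-regular languages. -/

section OmegaRegular

open Filter

variable {A S : Type*}

/-- `r` follows the transitions of the automaton on the input `w` from time `i` to time `k`. -/
def IsRunOn (step : S → A → Set S) (w : ℕ → A) (i k : ℕ) (r : ℕ → S) : Prop :=
  ∀ t, i ≤ t → t < k → r (t + 1) ∈ step (r t) (w t)

/-- The state `q` at time `k` can be reached from the state `p` at time `i`. -/
def Reaches (step : S → A → Set S) (w : ℕ → A) (i k : ℕ) (p q : S) : Prop :=
  ∃ r, IsRunOn step w i k r ∧ r i = p ∧ r k = q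

/-- The state `q` at time `k` can be reached from the state `p` at time `i` through an accepting
state. -/
def ReachesVia (step : S → A → Set S) (acc : Set S) (w : ℕ → A) (i k : ℕ) (p q : S) : Prop :=
  ∃ r, IsRunOn step w i k r ∧ r i = p ∧ r k = q ∧ ∃ t, i ≤ t ∧ t < k ∧ r t ∈ acc

/-- The positions `i` and `j` are indistinguishable for the automaton when it is observed at
time `k`. -/
def MergesAt (step : S → A → Set S) (acc : Set S) (w : ℕ → A) (k i j : ℕ) : Prop :=
  Reaches step w i k = Reaches step w j k ∧ ReachesVia step acc w i k = ReachesVia step acc w j k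

variable {step : S → A → Set S} {acc : Set S} {w : ℕ → A}

theorem IsRunOn.mono {i i' k k' : ℕ} {r : ℕ → S} (h : IsRunOn step w i k r) (hi : i ≤ i')
    (hk : k' ≤ k) : IsRunOn step w i' k' r :=
  fun t h₁ h₂ => h t (hi.trans h₁) (h₂.trans_le hk)

theorem IsRunOn.glue {i j k : ℕ} {r r' : ℕ → S} (h : IsRunOn step w i j r)
    (h' : IsRunOn step w j k r') (hj : r j = r' j) :
    IsRunOn step w i k (fun t => if t ≤ j then r t else r' t) := by
  intro t h₁ h₂
  rcases lt_trichotomy t j with ht | rfl | ht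
  · simpa [ht.le, Nat.succ_le_of_lt ht] using h t h₁ ht
  · simpa [hj] using h' t le_rfl h₂
  · simpa [ht.not_ge, show ¬ t + 1 ≤ j by omega] using h' t ht.le h₂

theorem reaches_iff_exists {i j k : ℕ} (hij : i ≤ j) (hjk : j ≤ k) (p q : S) :
    Reaches step w i k p q ↔ ∃ s, Reaches step w i j p s ∧ Reaches step w j k s q := by
  constructor
  · rintro ⟨r, hr, hp, hq⟩
    exact ⟨r j, ⟨r, hr.mono le_rfl hjk, hp, rfl⟩, r, hr.mono hij le_rfl, rfl, hq⟩
  · rintro ⟨s, ⟨r, hr, hp, hs⟩, r', hr', hs', hq⟩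
    refine ⟨_, hr.glue hr' (hs.trans hs'.symm), by simpa [hij] using hp, ?_⟩
    rcases hjk.eq_or_lt with rfl | hjk
    · simpa using hs.trans (hs'.symm.trans hq)
    · simpa [hjk.not_ge] using hq

theorem reachesVia_iff_exists {i j k : ℕ} (hij : i ≤ j) (hjk : j ≤ k) (p q : S) :
    ReachesVia step acc w i k p q ↔
      ∃ s, (ReachesVia step acc w i j p s ∧ Reaches step w j k s q) ∨
        (Reaches step w i j p s ∧ ReachesVia step acc w j k s q) := by
  constructor
  · rintro ⟨r, hr, hp, hq, t, h₁, h₂, ht⟩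
    refine ⟨r j, ?_⟩
    rcases lt_or_ge t j with htj | htj
    · exact .inl ⟨⟨r, hr.mono le_rfl hjk, hp, rfl, t, h₁, htj, ht⟩,
        r, hr.mono hij le_rfl, rfl, hq⟩
    · exact .inr ⟨⟨r, hr.mono le_rfl hjk, hp, rfl⟩,
        r, hr.mono hij le_rfl, rfl, hq, t, htj, h₂, ht⟩
  · rintro ⟨s, ⟨⟨r, hr, hp, hs, t, h₁, h₂, ht⟩, r', hr', hs', hq⟩ |
      ⟨⟨r, hr, hp, hs⟩, r', hr', hs', hq, t, h₁, h₂, ht⟩⟩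
    · refine ⟨_, hr.glue hr' (hs.trans hs'.symm), by simpa [hij] using hp, ?_,
        t, h₁, h₂.trans_le hjk, by simpa [h₂.le] using ht⟩
      rcases hjk.eq_or_lt with rfl | hjk
      · simpa using hs.trans (hs'.symm.trans hq)
      · simpa [hjk.not_ge] using hq
    · have hjk' : j < k := h₁.trans_lt h₂
      refine ⟨_, hr.glue hr' (hs.trans hs'.symm), by simpa [hij] using hp,
        by simpa [hjk'.not_ge] using hq, t, hij.trans h₁, h₂, ?_⟩
      rcases h₁.eq_or_lt with rfl | h₁
      · simpa [hs.trans hs'.symm] using ht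
      · simpa [h₁.not_ge] using ht

/-- A run up to time `l` splits at `k`, and its second half does not depend on the starting
position. -/
theorem MergesAt.mono {i j k l : ℕ} (h : MergesAt step acc w k i j) (hi : i ≤ k) (hj : j ≤ k)
    (hkl : k ≤ l) : MergesAt step acc w l i j := by
  constructor <;> ext p q
  · rw [reaches_iff_exists hi hkl, reaches_iff_exists hj hkl, h.1]
  · rw [reachesVia_iff_exists hi hkl, reachesVia_iff_exists hj hkl, h.1, h.2]

theorem IsRunOn.exists_concat {j : ℕ → ℕ} (hj : StrictMono j) {r : ℕ → ℕ → S} {p : S}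
    (hr : ∀ i, IsRunOn step w (j i) (j (i + 1)) (r i)) (h₀ : ∀ i, r i (j i) = p)
    (h₁ : ∀ i, r i (j (i + 1)) = p) :
    ∃ s : ℕ → S, (∀ i t, j i ≤ t → t ≤ j (i + 1) → s t = r i t) ∧
      ∀ t, j 0 ≤ t → s (t + 1) ∈ step (s t) (w t) := by
  classical
  have hex : ∀ t, ∃ i, t < j (i + 1) := fun t => ⟨t, Nat.lt_of_succ_le hj.le_apply⟩
  have hfind : ∀ i t, j i ≤ t → t < j (i + 1) → Nat.find (hex t) = i := by
    intro i t h₁ h₂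
    rw [Nat.find_eq_iff]
    exact ⟨h₂, fun n hn h => absurd (h₁.trans_lt h) (hj.monotone (by omega)).not_gt⟩
  have key : ∀ i t, j i ≤ t → t ≤ j (i + 1) → r (Nat.find (hex t)) t = r i t := by
    intro i t ht ht'
    rcases ht'.eq_or_lt with rfl | h
    · rw [hfind (i + 1) _ le_rfl (hj (by omega)), h₀, h₁]
    · rw [hfind i t ht h]
  refine ⟨fun t => r (Nat.find (hex t)) t, key, fun t ht => ?_⟩
  have hle : j (Nat.find (hex t)) ≤ t := by
    rcases h : Nat.find (hex t) with _ | n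
    · exact ht
    · exact not_lt.1 (Nat.find_min (hex t) (m := n) (by omega))
  have hlt := Nat.find_spec (hex t)
  have := hr _ t hle hlt
  rwa [← key _ (t + 1) (hle.trans (Nat.le_succ t)) hlt] at this

/-- If `j` merges with `n` at time `k`, then an accepting loop at `p` from `n` to some `j' ≥ k`
yields one from `j` to `j'`. Iterating gives consecutive accepting loops, which concatenate to a
run. -/
theorem exists_run_of_frequently_mergesAt {n : ℕ} {p : S}
    (h : ∀ N, ∃ j, N ≤ j ∧ n < j ∧ ReachesVia step acc w n j p p ∧
      ∃ k, j < k ∧ MergesAt step acc w k n j) :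
    ∃ s : ℕ → S, s n = p ∧ (∀ t, n ≤ t → s (t + 1) ∈ step (s t) (w t)) ∧
      ∀ N, ∃ t, N ≤ t ∧ s t ∈ acc := by
  let Good : Set ℕ := {j | n ≤ j ∧ ∃ k, j < k ∧ MergesAt step acc w k n j}
  have next : ∀ j : Good, ∃ j' : Good, j.1 < j'.1 ∧ ReachesVia step acc w j j' p p := by
    rintro ⟨j, hnj, k, hjk, hm⟩
    obtain ⟨j', hkj', hnj', hv, hg⟩ := h k
    refine ⟨⟨j', hnj'.le, hg⟩, hjk.trans_le hkj', ?_⟩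
    rwa [(hm.mono (hnj.trans hjk.le) hjk.le hkj').2] at hv
  choose nx hlt hvia using next
  -- The starting point `n` is good because it merges with itself.
  let g : ℕ → Good := fun i => nx^[i] ⟨n, le_rfl, n + 1, Nat.lt_succ_self n, rfl, rfl⟩
  have hg : ∀ i, g (i + 1) = nx (g i) := fun i => Function.iterate_succ_apply' _ _ _
  have hmono : StrictMono fun i => (g i).1 := strictMono_nat_of_lt_succ fun i => by
    rw [hg]; exact hlt _
  have hvia' : ∀ i, ReachesVia step acc w (g i) (g (i + 1)) p p := fun i => by
    rw [hg]; exact hvia _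
  choose r hr hp hq t h₁ h₂ ht using hvia'
  obtain ⟨s, hs, hstep⟩ := IsRunOn.exists_concat hmono hr hp hq
  refine ⟨s, (hs 0 n le_rfl (hmono.monotone (Nat.zero_le 1))).trans (hp 0), hstep, fun N => ?_⟩
  refine ⟨t N, le_trans hmono.le_apply (h₁ N), ?_⟩
  rw [hs N _ (h₁ N) (h₂ N).le]
  exact ht N

/-- Büchi acceptance in terms of countably many conditions on finite prefixes of the input. -/
theorem exists_accepting_run_iff [Finite S] (init : Set S) :
    (∃ r : ℕ → S, r 0 ∈ init ∧ (∀ t, r (t + 1) ∈ step (r t) (w t)) ∧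
      ∀ n, ∃ t, n ≤ t ∧ r t ∈ acc) ↔
    ∃ (n : ℕ) (p p₀ : S), (p₀ ∈ init ∧ Reaches step w 0 n p₀ p) ∧
      ∀ N, ∃ j, N ≤ j ∧ n < j ∧ ReachesVia step acc w n j p p ∧
        ∃ k, j < k ∧ MergesAt step acc w k n j := by
  constructor
  · rintro ⟨r, h₀, hstep, hacc⟩
    have hrun : ∀ i k, IsRunOn step w i k r := fun i k t _ _ => hstep t
    -- An ultrafilter replaces Ramsey's theorem: for fixed `t` the finitely-valued `T k t` is
    -- constant for almost all `k`. Positions sharing this limit value merge at some late `k`, and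
    -- the pigeonhole principle gives infinitely many that also share the run's state.
    let T : ℕ → ℕ → (S → S → Prop) × (S → S → Prop) := fun k t =>
      (Reaches step w t k, ReachesVia step acc w t k)
    have hc : ∀ t, ∃ c, ∀ᶠ k in (hyperfilter ℕ : Filter ℕ), T k t = c := fun t =>
      Ultrafilter.eventually_exists_iff.1 (Eventually.of_forall fun k => ⟨T k t, rfl⟩)
    choose c hc using hc
    obtain ⟨y, hy⟩ := Finite.exists_infinite_fiber fun t => (r t, c t)
    have hinf : ((fun t => (r t, c t)) ⁻¹' {y}).Infinite := Set.infinite_coe_iff.1 hy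
    obtain ⟨n, hn⟩ := hinf.nonempty
    refine ⟨n, r n, r 0, ⟨h₀, r, hrun _ _, rfl, rfl⟩, fun N => ?_⟩
    obtain ⟨t, hnt, ht⟩ := hacc n
    obtain ⟨j, hj, hlt⟩ := hinf.exists_gt (max N t)
    have hnj : (r n, c n) = (r j, c j) := hn.trans hj.symm
    rw [max_lt_iff] at hlt
    rw [Prod.mk.injEq] at hnj
    refine ⟨j, hlt.1.le, hnt.trans_lt hlt.2,
      ⟨r, hrun _ _, rfl, hnj.1.symm, t, hnt, hlt.2, ht⟩, ?_⟩
    have hgt : ∀ᶠ k in (hyperfilter ℕ : Filter ℕ), j < k :=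
      Nat.hyperfilter_le_atTop (eventually_gt_atTop j)
    obtain ⟨k, h₁, h₂, hk⟩ := ((hc n).and ((hc j).and hgt)).exists
    exact ⟨k, hk, Prod.mk.injEq .. |>.mp (h₁.trans (hnj.2.trans h₂.symm))⟩
  · rintro ⟨n, p, p₀, ⟨h₀, r, hr, hr₀, hrn⟩, h⟩
    obtain ⟨s, hsn, hs, hacc⟩ := exists_run_of_frequently_mergesAt h
    have hs' : ∀ k, IsRunOn step w n k s := fun k t ht _ => hs t ht
    refine ⟨fun t => if t ≤ n then r t else s t, by simpa [hr₀] using h₀, fun t => ?_,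
      fun N => ?_⟩
    · exact hr.glue (hs' (t + 1)) (hrn.trans hsn.symm) t (Nat.zero_le t) (Nat.lt_succ_self t)
    -- The bound `n + 1` places the accepting visit after the splice, where the glued run follows
    -- `s`.
    · obtain ⟨t, ht, hta⟩ := hacc (max N (n + 1))
      rw [max_le_iff] at ht
      exact ⟨t, ht.1, by simpa [show ¬ t ≤ n by omega] using hta⟩

theorem measurableSet_of_prefix [Finite A] [MeasurableSpace A] [MeasurableSingletonClass A]
    {s : Set (ℕ → A)} (k : ℕ) (h : ∀ w w' : ℕ → A, (∀ t < k, w t = w' t) → w ∈ s → w' ∈ s) :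
    MeasurableSet s := by
  let f : (ℕ → A) → (Fin k → A) := fun w i => w i
  have hf : Measurable f := measurable_pi_lambda _ fun i => measurable_pi_apply _
  have : s = f ⁻¹' (f '' s) := by
    refine (Set.subset_preimage_image f s).antisymm ?_
    rintro w' ⟨w, hw, hww'⟩
    exact h w w' (fun t ht => congrFun hww' ⟨t, ht⟩) hw
  rw [this]
  exact hf (Set.toFinite _).measurableSet

theorem IsRunOn.congr {w' : ℕ → A} {i k : ℕ} {r : ℕ → S} (h : ∀ t < k, w t = w' t)
    (hr : IsRunOn step w i k r) : IsRunOn step w' i k r :=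
  fun t h₁ h₂ => h t h₂ ▸ hr t h₁ h₂

theorem reaches_congr {w' : ℕ → A} {i k : ℕ} (h : ∀ t < k, w t = w' t) :
    Reaches step w i k = Reaches step w' i k := by
  ext p q
  exact ⟨fun ⟨r, hr, h'⟩ => ⟨r, hr.congr h, h'⟩,
    fun ⟨r, hr, h'⟩ => ⟨r, hr.congr fun t ht => (h t ht).symm, h'⟩⟩

theorem reachesVia_congr {w' : ℕ → A} {i k : ℕ} (h : ∀ t < k, w t = w' t) :
    ReachesVia step acc w i k = ReachesVia step acc w' i k := by
  ext p q
  exact ⟨fun ⟨r, hr, h'⟩ => ⟨r, hr.congr h, h'⟩,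
    fun ⟨r, hr, h'⟩ => ⟨r, hr.congr fun t ht => (h t ht).symm, h'⟩⟩

/-- Every ω-regular set over a finite alphabet is Borel. -/
theorem IsOmegaRegular.measurableSet [Finite A] [MeasurableSpace A] [MeasurableSingletonClass A]
    {Ψ : Set (ℕ → A)} (hΨ : IsOmegaRegular Ψ) : MeasurableSet Ψ := by
  obtain ⟨m, init, step, acc, rfl⟩ := hΨ
  have hR : ∀ i k p q, MeasurableSet {w | Reaches step w i k p q} := fun i k p q =>
    measurableSet_of_prefix k fun w w' h hw => by
      rwa [Set.mem_ofPred_eq, ← reaches_congr h]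
  have hV : ∀ i k p q, MeasurableSet {w | ReachesVia step acc w i k p q} := fun i k p q =>
    measurableSet_of_prefix k fun w w' h hw => by
      rwa [Set.mem_ofPred_eq, ← reachesVia_congr h]
  have hM : ∀ k i j, MeasurableSet {w | MergesAt step acc w k i j} := fun k i j =>
    measurableSet_of_prefix k fun w w' h hw => by
      rwa [Set.mem_ofPred_eq, MergesAt, ← reaches_congr h, ← reaches_congr h,
        ← reachesVia_congr h, ← reachesVia_congr h]
  simp only [exists_accepting_run_iff]
  refine measurableSet_setOfPred.2 (.exists fun n => .exists fun p => .exists fun p₀ =>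
    .and (.and measurable_const (measurableSet_setOfPred.1 (hR _ _ _ _))) ?_)
  exact .forall fun N => .exists fun j => .and measurable_const <| .and measurable_const <|
    .and (measurableSet_setOfPred.1 (hV _ _ _ _)) <| .exists fun k =>
    .and measurable_const (measurableSet_setOfPred.1 (hM _ _ _))

end OmegaRegular

/-! ### Deterministic policies and the construction of processes. -/

namespace ControlPolicy

variable {X U : Type*} [MeasurableSpace X] [MeasurableSpace U]

/-- The control values that the policy `φ` produces along a state path. -/
def controls (φ : ControlPolicy X U) (x : ℕ → X) (t : ℕ) : U :=
  φ.rule t (fun i => x i, fun i => φ.controls x i)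
termination_by t
decreasing_by exact i.2

theorem controls_congr (φ : ControlPolicy X U) {x y : ℕ → X} (t : ℕ)
    (h : ∀ i ≤ t, x i = y i) : φ.controls x t = φ.controls y t := by
  induction t using Nat.strong_induction_on with
  | _ t ih =>
    rw [controls, controls]
    congr 2
    · funext i
      exact h i (Nat.lt_succ_iff.1 i.2)
    · funext i
      exact ih i i.2 fun j hj => h j (hj.trans i.2.le)

theorem measurable_controls (φ : ControlPolicy X U) (t : ℕ) :
    Measurable fun x : ℕ → X => φ.controls x t := by
  induction t using Nat.strong_induction_on with
  | _ t ih =>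
    have h : (fun x : ℕ → X => φ.controls x t) =
        fun x => φ.rule t (fun i => x i, fun i => φ.controls x i) :=
      funext fun x => by rw [controls]
    rw [h]
    exact (φ.measurable_rule t).comp <| .prodMk
      (measurable_pi_lambda _ fun i => measurable_pi_apply _)
      (measurable_pi_lambda _ fun i => ih i i.2)

/-- The controlled path that the policy `φ` generates along a state path. -/
def path (φ : ControlPolicy X U) (x : ℕ → X) (t : ℕ) : X × U :=
  (x t, φ.controls x t)

theorem measurable_path (φ : ControlPolicy X U) : Measurable φ.path :=
  measurable_pi_lambda _ fun t => (measurable_pi_apply t).prodMk (φ.measurable_controls t)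

end ControlPolicy

theorem MeasureTheory.map_eval_zero_trajMeasure {X : ℕ → Type*} [∀ n, MeasurableSpace (X n)]
    (ν : Measure (X 0))
    (K : (n : ℕ) → Kernel ((i : Finset.Iic n) → X i) (X (n + 1))) [∀ n, IsMarkovKernel (K n)] :
    (Kernel.trajMeasure ν K).map (fun x => x 0) = ν := by
  let e : ((i : Finset.Iic 0) → X i) → X 0 := fun h => h ⟨0, Finset.mem_Iic.2 le_rfl⟩
  have he : Measurable e := measurable_pi_apply _
  change (Kernel.trajMeasure ν K).map (e ∘ Preorder.frestrictLe 0) = ν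
  rw [← Measure.map_map he (Preorder.measurable_frestrictLe 0),
    Kernel.trajMeasure, Measure.map_comp _ _ (Preorder.measurable_frestrictLe 0),
    Kernel.traj_map_frestrictLe, Kernel.partialTraj_self, Measure.id_comp]
  refine (Measure.map_map (μ := ν) he
    (MeasurableEquiv.measurable (MeasurableEquiv.piUnique fun i : Finset.Iic 0 => X i).symm)).trans ?_
  exact Measure.map_id

/-- A process with prescribed initial law, policy and conditional laws of the next state. -/
theorem ControlPolicy.exists_law {X U : Type*} [MeasurableSpace X] [StandardBorelSpace X]
    [Nonempty X] [MeasurableSpace U] [MeasurableEq U] (φ : ControlPolicy X U)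
    (ν : ProbabilityMeasure X) (K : (t : ℕ) → Kernel (Fin (t + 1) → X × U) X)
    [∀ t, IsMarkovKernel (K t)] :
    ∃ P : ProbabilityMeasure (ℕ → X × U),
      (P : Measure (ℕ → X × U)).map (fun ω => (ω 0).1) = (ν : Measure X) ∧
      (∀ t : ℕ, ∀ᵐ ω ∂(P : Measure (ℕ → X × U)),
        (ω t).2 = φ.rule t (fun i => (ω i).1, fun i => (ω i).2)) ∧
      ∀ t : ℕ, ∀ᵐ ω ∂(P : Measure (ℕ → X × U)),
        condDistrib (fun ω' : ℕ → X × U => (ω' (t + 1)).1)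
          (fun (ω' : ℕ → X × U) (i : Fin (t + 1)) => ω' i) (P : Measure (ℕ → X × U))
          (fun i : Fin (t + 1) => ω i) = K t (fun i : Fin (t + 1) => ω i) := by
  -- Histories are extended constantly so that `φ.path` applies; the values after time `t` do not
  -- affect the controls up to `t`.
  let e : (t : ℕ) → (Finset.Iic t → X) → ℕ → X := fun t h n =>
    h ⟨min n t, Finset.mem_Iic.2 (min_le_right n t)⟩
  have he : ∀ t, Measurable (e t) := fun t =>
    measurable_pi_lambda _ fun n => measurable_pi_apply _
  let G : (t : ℕ) → (Finset.Iic t → X) → Fin (t + 1) → X × U := fun t h i => φ.path (e t h) i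
  have hG : ∀ t, Measurable (G t) := fun t => measurable_pi_lambda _ fun i =>
    measurable_pi_iff.1 (φ.measurable_path.comp (he t)) i
  let κ : (t : ℕ) → Kernel (Finset.Iic t → X) X := fun t => (K t).comap (G t) (hG t)
  -- Only the state path is random: its law comes from Ionescu-Tulcea, and the controls are
  -- functions of it.
  let μ : Measure (ℕ → X) := Kernel.trajMeasure (X := fun _ => X) (ν : Measure X) κ
  have hpath := φ.measurable_path
  have hhist : ∀ t, Measurable fun (ω : ℕ → X × U) (i : Fin (t + 1)) => ω i := fun t =>
    measurable_pi_lambda _ fun i => measurable_pi_apply _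
  have hGpath : ∀ t, G t ∘ Preorder.frestrictLe (π := fun _ => X) t =
      fun (x : ℕ → X) (i : Fin (t + 1)) => φ.path x i := by
    intro t
    funext x i
    have hi : (i : ℕ) ≤ t := Nat.lt_succ_iff.1 i.2
    refine Prod.ext ?_ (φ.controls_congr _ fun j hj => ?_)
    · simp [G, e, ControlPolicy.path, min_eq_left hi]
    · simp [e, min_eq_left (hj.trans hi)]
  have hstep : ∀ t, HasCondDistrib (fun x : ℕ → X => x (t + 1))
      (fun (x : ℕ → X) (i : Fin (t + 1)) => φ.path x i) (K t) μ := by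
    intro t
    rw [← hGpath]
    refine HasCondDistrib.comp_right (hf := hG t) ⟨?_, ?_⟩
    · exact ((Preorder.measurable_frestrictLe t).prodMk (measurable_pi_apply _)).aemeasurable
    · exact Kernel.map_frestrictLe_trajMeasure_compProd_eq_map_trajMeasure.symm
  let P : ProbabilityMeasure (ℕ → X × U) :=
    ⟨μ.map φ.path, Measure.isProbabilityMeasure_map hpath.aemeasurable⟩
  refine ⟨P, ?_, fun t => ?_, fun t => ?_⟩
  · change (μ.map φ.path).map _ = _
    rw [Measure.map_map (by fun_prop) hpath]
    exact map_eval_zero_trajMeasure _ _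
  · change ∀ᵐ ω ∂(μ.map φ.path), _
    rw [ae_map_iff hpath.aemeasurable]
    · refine .of_forall fun x => ?_
      change φ.controls x t = _
      rw [ControlPolicy.controls]
      rfl
    · refine measurableSet_eq_fun (by fun_prop) ((φ.measurable_rule t).comp (by fun_prop))
  · refine ae_of_ae_map (hhist t).aemeasurable
      (p := fun h => condDistrib _ _ (P : Measure (ℕ → X × U)) h = K t h) ?_
    refine condDistrib_ae_eq_of_measure_eq_compProd _
      (measurable_pi_apply (t + 1)).fst.aemeasurable ?_
    change (μ.map φ.path).map _ = (μ.map φ.path).map _ ⊗ₘ _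
    rw [Measure.map_map (by fun_prop) hpath, Measure.map_map (by fun_prop) hpath]
    exact (hstep t).map_eq

/-! ### Transfer between the concrete system and its abstraction. -/

section Abstraction

variable {X U Q Act AP : Type*} [MeasurableSpace X] [MeasurableSpace U] [MeasurableSpace Q]
  [MeasurableSpace Act]

/-- At an atom `h` the coarse conditional law is an elementary conditional probability, hence the
average of the fine conditional probabilities over the event `f ∘ H = h`. -/
theorem ProbabilityTheory.condDistrib_comp_real_mem_Icc {Ω 𝓗 𝓕 : Type*} [MeasurableSpace Ω]
    [MeasurableSpace 𝓗] [MeasurableSpace 𝓕] [MeasurableSingletonClass 𝓕]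
    [StandardBorelSpace X] [Nonempty X] [StandardBorelSpace Q] [Nonempty Q]
    {P : Measure Ω} [IsProbabilityMeasure P] {H : Ω → 𝓗} (hH : Measurable H)
    {Y : Ω → X} (hY : Measurable Y) {f : 𝓗 → 𝓕} (hf : Measurable f)
    {g : X → Q} (hg : Measurable g) {s : Set Q} (hs : MeasurableSet s) {l u : ℝ} {h : 𝓕}
    (h₀ : P.map (f ∘ H) {h} ≠ 0)
    (hb : ∀ᵐ ω ∂P, f (H ω) = h → (condDistrib Y H P (H ω)).real (g ⁻¹' s) ∈ Set.Icc l u) :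
    (condDistrib (g ∘ Y) (f ∘ H) P h).real s ∈ Set.Icc l u := by
  have hfH : Measurable (f ∘ H) := hf.comp hH
  let A : Set Ω := H ⁻¹' (f ⁻¹' {h})
  have hfh : MeasurableSet (f ⁻¹' {h}) := hf (measurableSet_singleton h)
  have hA : MeasurableSet A := hH hfh
  have hPA : P.map (f ∘ H) {h} = P A := Measure.map_apply hfH (measurableSet_singleton h)
  rw [hPA] at h₀
  have hval : condDistrib (g ∘ Y) (f ∘ H) P h s = (P A)⁻¹ * P (A ∩ Y ⁻¹' (g ⁻¹' s)) := by
    rw [condDistrib_apply_of_ne_zero (hg.comp hY) h (by rwa [hPA]), hPA,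
      Measure.map_apply (hfH.prodMk (hg.comp hY)) ((measurableSet_singleton h).prod hs)]
    rfl
  have hint := setLIntegral_preimage_condDistrib (μ := P) hH hY.aemeasurable (hg hs) hfh
  have hb' : ∀ᵐ ω ∂P.restrict A,
      (condDistrib Y H P (H ω)).real (g ⁻¹' s) ∈ Set.Icc l u :=
    (ae_restrict_iff' hA).2 hb
  have hne : P.restrict A ≠ 0 := by rwa [Ne, Measure.restrict_eq_zero]
  have : (ae (P.restrict A)).NeBot := ae_neBot.2 hne
  obtain ⟨ω, hω⟩ := hb'.exists
  -- `ENNReal.ofReal` truncates negative numbers, so the upper estimate needs `0 ≤ u`.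
  have hu : 0 ≤ u := measureReal_nonneg.trans hω.2
  have hconst : ∀ c : ENNReal, ∫⁻ _ in A, c ∂P = c * P A := fun c => setLIntegral_const A c
  have hlow : ENNReal.ofReal l * P A ≤ P (A ∩ Y ⁻¹' (g ⁻¹' s)) := by
    rw [← hconst, ← hint]
    exact lintegral_mono_ae (hb'.mono fun ω h => ENNReal.ofReal_le_of_le_toReal h.1)
  have hupp : P (A ∩ Y ⁻¹' (g ⁻¹' s)) ≤ ENNReal.ofReal u * P A := by
    rw [← hconst, ← hint]
    exact lintegral_mono_ae (hb'.mono fun ω h =>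
      (ENNReal.le_ofReal_iff_toReal_le (measure_ne_top _ _) hu).2 h.2)
  rw [Measure.real, hval, mul_comm, ← div_eq_mul_inv]
  constructor
  · refine (ENNReal.ofReal_le_iff_le_toReal
      (ENNReal.div_ne_top (measure_ne_top _ _) h₀)).1 ?_
    exact (ENNReal.le_div_iff_mul_le (.inl h₀) (.inl (measure_ne_top _ _))).2 hlow
  · refine ENNReal.toReal_le_of_le_ofReal hu ?_
    exact ENNReal.div_le_of_le_mul hupp

/-- Constant extension of a finite history to an infinite path. -/
def extendHistory {Z : Type*} {t : ℕ} (h : Fin (t + 1) → Z) (n : ℕ) : Z :=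
  h ⟨min n t, Nat.lt_succ_of_le (min_le_right n t)⟩

theorem extendHistory_of_le {Z : Type*} {t i : ℕ} (z : ℕ → Z) (hi : i ≤ t) :
    extendHistory (fun i : Fin (t + 1) => z i) i = z i := by
  simp [extendHistory, min_eq_left hi]

theorem measurable_extendHistory {Z : Type*} [MeasurableSpace Z] (t : ℕ) :
    Measurable (extendHistory : (Fin (t + 1) → Z) → ℕ → Z) :=
  measurable_pi_lambda _ fun _ => measurable_pi_apply _

/-- The policy that abstracts the states by `cell`, runs the policy `κ` on them, and refines the
resulting actions by `sel`. -/
def ControlPolicy.refine [Countable Q] [Countable Act] [DiscreteMeasurableSpace Q]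
    [DiscreteMeasurableSpace Act] (κ : ControlPolicy Q Act) {cell : X → Q}
    (hcell : Measurable cell) (sel : Q × Act → U) : ControlPolicy X U where
  -- Past actions are recomputed from the cells, since `sel` need not be injective and the past
  -- controls may not reveal them.
  rule t h := sel (κ.path (fun n => cell (extendHistory h.1 n)) t)
  measurable_rule t := by
    refine (Measurable.of_discrete (f := sel)).comp ?_
    have hcells : Measurable fun (h : (Fin (t + 1) → X) × (Fin t → U)) (n : ℕ) =>
        cell (extendHistory h.1 n) := measurable_pi_lambda _ fun n => hcell.comp
      ((measurable_pi_iff.1 (measurable_extendHistory t) n).comp measurable_fst)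
    exact measurable_pi_iff.1 (κ.measurable_path.comp hcells) t

omit [MeasurableSpace X] in
theorem ControlPolicy.path_extendHistory (κ : ControlPolicy Q Act) (cell : X → Q) (x : ℕ → X)
    {t i : ℕ} (hi : i ≤ t) :
    κ.path (fun n => cell (extendHistory (fun i : Fin (t + 1) => x i) n)) i =
      κ.path (fun n => cell (x n)) i := by
  refine Prod.ext ?_ (κ.controls_congr _ fun j hj => ?_)
  · exact congrArg cell (extendHistory_of_le x hi)
  · exact congrArg cell (extendHistory_of_le x (hj.trans hi))

theorem ControlPolicy.refine_rule [Countable Q] [Countable Act] [DiscreteMeasurableSpace Q]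
    [DiscreteMeasurableSpace Act] (κ : ControlPolicy Q Act) {cell : X → Q}
    (hcell : Measurable cell) (sel : Q × Act → U) (t : ℕ) (x : ℕ → X) (u : Fin t → U) :
    (κ.refine hcell sel).rule t (fun i => x i, u) =
      sel (κ.path (fun n => cell (x n)) t) :=
  congrArg sel (κ.path_extendHistory cell x le_rfl)

/-- The abstract controlled path of a concrete path. -/
def ControlPolicy.abstractPath (κ : ControlPolicy Q Act) (cell : X → Q) (ω : ℕ → X × U) :
    ℕ → Q × Act :=
  κ.path fun n => cell (ω n).1

theorem ControlPolicy.measurable_abstractPath (κ : ControlPolicy Q Act) {cell : X → Q}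
    (hcell : Measurable cell) :
    Measurable (κ.abstractPath cell : (ℕ → X × U) → ℕ → Q × Act) :=
  κ.measurable_path.comp <| measurable_pi_lambda _ fun n =>
    hcell.comp (measurable_pi_apply n).fst

theorem ControlledMarkovSystem.laws_refine_nonempty [StandardBorelSpace X] [Nonempty X]
    [MeasurableEq U] [Countable Q] [Countable Act] [DiscreteMeasurableSpace Q]
    [DiscreteMeasurableSpace Act] (S : ControlledMarkovSystem X U AP)
    (hS : ∀ u, (S.trans u).Nonempty) (κ : ControlPolicy Q Act) {cell : X → Q}
    (hcell : Measurable cell) (sel : Q × Act → U) (ν : ProbabilityMeasure X) :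
    (S.laws (κ.refine hcell sel) ν).Nonempty := by
  choose T hT using hS
  -- The choice of `T` is indexed by the countable set `Q × Act`, so no measurable selection is
  -- needed.
  let K₀ : Kernel ((Q × Act) × X) X :=
    { toFun := fun p => (T (sel p.1)).1 p.2
      measurable' := measurable_from_prod_countable_right fun c => (T (sel c)).1.measurable }
  have : IsMarkovKernel K₀ := ⟨fun p => (T (sel p.1)).2.isProbabilityMeasure p.2⟩
  let f : (t : ℕ) → (Fin (t + 1) → X × U) → (Q × Act) × X := fun t h =>
    (κ.path (fun n => cell (extendHistory h n).1) t, (h (Fin.last t)).1)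
  have hf : ∀ t, Measurable (f t) := fun t =>
    ((measurable_pi_iff.1 (κ.measurable_abstractPath hcell) t).comp
      (measurable_extendHistory t)).prodMk (measurable_pi_apply _).fst
  obtain ⟨P, h₀, hctrl, hP⟩ := (κ.refine hcell sel).exists_law ν fun t => K₀.comap (f t) (hf t)
  refine ⟨P, h₀, hctrl, fun t => ?_⟩
  filter_upwards [hctrl t, hP t] with ω hω hω'
  have hpath : κ.path (fun n => cell (extendHistory (fun i : Fin (t + 1) => ω i) n).1) t =
      κ.path (fun n => cell (ω n).1) t :=
    κ.path_extendHistory (fun z : X × U => cell z.1) ω le_rfl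
  refine ⟨T (ω t).2, hT _, ?_⟩
  rw [hω', hω, κ.refine_rule hcell sel t (fun n => (ω n).1), ← hpath]
  rfl

theorem ControlledMarkovSystem.map_abstractPath_mem_laws [StandardBorelSpace X] [Nonempty X]
    [Finite Q] [Nonempty Q] [DiscreteMeasurableSpace Q] [Finite Act]
    [DiscreteMeasurableSpace Act] (S : ControlledMarkovSystem X U AP)
    (B : BMDP Q Act AP) (κ : ControlPolicy Q Act) {cell : X → Q} (hcell : Measurable cell)
    (sel : Q × Act → U)
    (hsel : ∀ q a, ∀ T ∈ S.trans (sel (q, a)), ∀ x, cell x = q →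
      ∃ Θ ∈ B.toSystem.trans a, ∀ q', T.1 x (cell ⁻¹' {q'}) = Θ.1 q {q'})
    {q₀ : Q} {ν : ProbabilityMeasure X} (hν : (ν : Measure X) (cell ⁻¹' {q₀}) = 1)
    {P : ProbabilityMeasure (ℕ → X × U)} (hP : P ∈ S.laws (κ.refine hcell sel) ν) :
    P.map (κ.measurable_abstractPath hcell).aemeasurable ∈
      B.toSystem.laws κ ⟨Measure.dirac q₀, inferInstance⟩ := by
  classical
  obtain ⟨h₀, hctrl, hstep⟩ := hP
  have hg := κ.measurable_abstractPath (U := U) hcell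
  have hhist : ∀ t, Measurable fun (ω : ℕ → Q × Act) (i : Fin (t + 1)) => ω i := fun t =>
    measurable_pi_lambda _ fun i => measurable_pi_apply _
  have hhistX : ∀ t, Measurable fun (ω : ℕ → X × U) (i : Fin (t + 1)) => ω i := fun t =>
    measurable_pi_lambda _ fun i => measurable_pi_apply _
  refine ⟨?_, fun t => ?_, fun t => ?_⟩
  · change ((P : Measure (ℕ → X × U)).map (κ.abstractPath cell)).map _ = Measure.dirac q₀
    rw [Measure.map_map (measurable_pi_apply 0).fst hg]
    have hν' : ∀ᵐ x ∂(ν : Measure X), cell x = q₀ :=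
      (prob_compl_eq_zero_iff (hcell (measurableSet_singleton q₀))).2 hν
    rw [← h₀] at hν'
    have := ae_of_ae_map (measurable_pi_apply 0).fst.aemeasurable hν'
    refine (Measure.map_congr (g := fun _ => q₀) this).trans ?_
    simp [Measure.map_const]
  · change ∀ᵐ ω ∂((P : Measure (ℕ → X × U)).map (κ.abstractPath cell)), _
    rw [ae_map_iff hg.aemeasurable]
    · refine .of_forall fun ω => ?_
      change κ.controls _ t = _
      rw [ControlPolicy.controls]
      rfl
    · refine measurableSet_eq_fun (by fun_prop) ((κ.measurable_rule t).comp (by fun_prop))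
  · let f : (Fin (t + 1) → X × U) → Fin (t + 1) → Q × Act := fun h i =>
      κ.abstractPath cell (extendHistory h) i
    have hf : Measurable f := measurable_pi_lambda _ fun i =>
      (measurable_pi_iff.1 (hg.comp (measurable_extendHistory t)) i)
    have hfH : (fun (ω : ℕ → Q × Act) (i : Fin (t + 1)) => ω i) ∘ κ.abstractPath cell =
        f ∘ fun (ω : ℕ → X × U) (i : Fin (t + 1)) => ω i := by
      funext ω i
      exact (κ.path_extendHistory (fun z : X × U => cell z.1) ω (Nat.lt_succ_iff.1 i.2)).symm
    refine ae_of_ae_map (hhist t).aemeasurable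
      (p := fun h => ∃ T ∈ B.toSystem.trans (h (Fin.last t)).2,
        condDistrib (fun ω' : ℕ → Q × Act => (ω' (t + 1)).1)
        (fun (ω' : ℕ → Q × Act) (i : Fin (t + 1)) => ω' i)
        ((P : Measure (ℕ → X × U)).map (κ.abstractPath cell)) h = T.1 (h (Fin.last t)).1) ?_
    -- Abstract histories form a finite set, so only those of positive mass need checking.
    rw [ae_iff_of_countable]
    intro h hh
    change (((P : Measure (ℕ → X × U)).map (κ.abstractPath cell)).map _) {h} ≠ 0 at hh
    rw [Measure.map_map (hhist t) hg] at hh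
    have hcond_ae := condDistrib_map (ν := (P : Measure (ℕ → X × U))) (f := κ.abstractPath cell)
      (X := fun (ω' : ℕ → Q × Act) (i : Fin (t + 1)) => ω' i)
      (Y := fun ω' : ℕ → Q × Act => (ω' (t + 1)).1) (hhist t).aemeasurable
      (measurable_pi_apply (t + 1)).fst.aemeasurable hg.aemeasurable
    have hcond := (ae_iff_of_countable.1 hcond_ae) h hh
    rw [hcond]
    rw [hfH] at hh ⊢
    have hrow : ∀ᵐ ω ∂(P : Measure (ℕ → X × U)),
        f (fun i : Fin (t + 1) => ω i) = h →
          ∃ Θ ∈ B.toSystem.trans (h (Fin.last t)).2, ∀ q',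
            condDistrib (fun ω' : ℕ → X × U => (ω' (t + 1)).1)
              (fun (ω' : ℕ → X × U) (i : Fin (t + 1)) => ω' i) (P : Measure (ℕ → X × U))
              (fun i : Fin (t + 1) => ω i) (cell ⁻¹' {q'}) = Θ.1 (h (Fin.last t)).1 {q'} := by
      filter_upwards [hctrl t, hstep t] with ω hω ⟨T, hT, hTω⟩ hfω
      have hlast : κ.path (fun n => cell (ω n).1) t = h (Fin.last t) := by
        rw [← hfω]
        exact (κ.path_extendHistory (fun z : X × U => cell z.1) ω le_rfl).symm
      rw [hω, κ.refine_rule hcell sel t (fun n => (ω n).1), hlast] at hT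
      obtain ⟨Θ, hΘ, hΘ'⟩ := hsel _ _ T hT (ω t).1 (congrArg Prod.fst hlast)
      exact ⟨Θ, hΘ, fun q' => by rw [hTω, hΘ']⟩
    have hmem : ∀ q', (condDistrib (cell ∘ fun ω' : ℕ → X × U => (ω' (t + 1)).1)
        (f ∘ fun (ω' : ℕ → X × U) (i : Fin (t + 1)) => ω' i) (P : Measure (ℕ → X × U)) h).real
          {q'} ∈ Set.Icc (B.lower (h (Fin.last t)).2 (h (Fin.last t)).1 q')
            (B.upper (h (Fin.last t)).2 (h (Fin.last t)).1 q') := by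
      intro q'
      refine condDistrib_comp_real_mem_Icc (hhistX t) (measurable_pi_apply (t + 1)).fst hf hcell
        (measurableSet_singleton q') hh ?_
      filter_upwards [hrow] with ω hω hfω
      obtain ⟨Θ, hΘ, hΘ'⟩ := hω hfω
      rw [Measure.real, hΘ']
      exact hΘ _ _
    -- Some admissible matrix exists, since otherwise `hrow` would make `h` a null history.
    obtain ⟨Θ, hΘ⟩ : ∃ Θ, Θ ∈ B.toSystem.trans (h (Fin.last t)).2 := by
      by_contra hne
      refine hh ?_
      rw [Measure.map_apply (hf.comp (hhistX t)) (measurableSet_singleton h)]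
      refine measure_mono_null (fun ω hω => ?_) hrow
      exact fun hω' => hne ((hω' hω).imp fun Θ hΘ => hΘ.1)
    let ρ := condDistrib (cell ∘ fun ω' : ℕ → X × U => (ω' (t + 1)).1)
        (f ∘ fun (ω' : ℕ → X × U) (i : Fin (t + 1)) => ω' i) (P : Measure (ℕ → X × U)) h
    -- The bounds constrain each row separately, so the current row of `Θ` can be replaced by the
    -- conditional law.
    let Θ' : Kernel Q Q :=
      Kernel.ofFunOfCountable fun i => if i = (h (Fin.last t)).1 then ρ else Θ.1 i
    have hΘ'_self : Θ' (h (Fin.last t)).1 = ρ := if_pos rfl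
    have hΘ'_ne : ∀ i, i ≠ (h (Fin.last t)).1 → Θ' i = Θ.1 i := fun i hi => if_neg hi
    have hM : IsMarkovKernel Θ' := ⟨fun i => by
      by_cases hi : i = (h (Fin.last t)).1
      · rw [hi, hΘ'_self]
        infer_instance
      · rw [hΘ'_ne i hi]
        exact Θ.2.isProbabilityMeasure i⟩
    refine ⟨⟨Θ', hM⟩, fun i j => ?_, hΘ'_self.symm⟩
    by_cases hi : i = (h (Fin.last t)).1
    · rw [hi, hΘ'_self]
      exact hmem j
    · rw [hΘ'_ne i hi]
      exact hΘ i j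

end Abstraction

/-! ### The refinement theorem. -/

theorem mainTheorem4
    {X U Q Act AP : Type*}
    [TopologicalSpace X] [PolishSpace X] [MeasurableSpace X] [BorelSpace X] [Nonempty X]
    [TopologicalSpace U] [CompactSpace U] [TopologicalSpace.MetrizableSpace U]
    [MeasurableSpace U] [BorelSpace U]
    [Finite Q] [Nonempty Q] [MeasurableSpace Q] [DiscreteMeasurableSpace Q]
    [Finite Act] [MeasurableSpace Act] [DiscreteMeasurableSpace Act]
    [Finite AP]
    (XU : ControlledMarkovSystem X U AP) (hXU : ∀ u, (XU.trans u).Nonempty)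
    (IA : BMDP Q Act AP)
    (α : Set (X × Q)) (hα : IsMeasurablePartition α)
    (R : Set (ProbabilityMeasure X × ProbabilityMeasure Q))
    (hR : Abstracts XU IA.toSystem α R)
    (Ψ : Set (ℕ → Set AP)) (hΨ : IsOmegaRegular Ψ)
    (c : Comparison) (ρ : ℝ) (hρ : ρ ∈ Set.Icc (0 : ℝ) 1)
    (q₀ : Q)
    (κ : ControlPolicy Q Act)
    (hκ : ∀ P ∈ IA.toSystem.laws κ ⟨Measure.dirac q₀, inferInstance⟩,
      IA.toSystem.Satisfies P c ρ Ψ) :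
    ∃ φ : ControlPolicy X U, ∀ ν₀ : ProbabilityMeasure X,
      (ν₀ : Measure X) (relPreimage α q₀) = 1 →
        (XU.laws φ ν₀).Nonempty ∧ ∀ P ∈ XU.laws φ ν₀, XU.Satisfies P c ρ Ψ := by
  choose cell hmem huniq using hα.1
  have hpre : ∀ q, relPreimage α q = cell ⁻¹' {q} := fun q =>
    Set.ext fun x => ⟨fun hx => (huniq x q hx).symm, fun hx => hx ▸ hmem x⟩
  have hcell : Measurable cell := measurable_to_countable' fun q => hpre q ▸ hα.2 q
  have hlabel : ∀ x, IA.toSystem.label (cell x) = XU.label x := fun x => by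
    obtain ⟨q, hq, hl⟩ := hR.state_level x
    rw [← hl, huniq x q hq]
  choose sel hsel using fun p : Q × Act => hR.measure_level p.1 p.2
  -- Second countability makes the diagonal of `U` measurable, as the existence of processes
  -- requires.
  have : SecondCountableTopology U :=
    letI := TopologicalSpace.metrizableSpaceMetric U
    inferInstance
  refine ⟨κ.refine hcell sel, fun ν₀ hν₀ =>
    ⟨XU.laws_refine_nonempty hXU κ hcell sel ν₀, fun P hP => ?_⟩⟩
  rw [hpre] at hν₀
  have hsat := hκ _ <| XU.map_abstractPath_mem_laws IA κ hcell sel (fun q a T hT x hx => by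
    obtain ⟨Θ, hΘ, -, h⟩ := hsel (q, a) T hT x (hx ▸ hmem x)
    exact ⟨Θ, hΘ, fun q' => by rw [← hpre, h]⟩) hν₀ hP
  have hmeas : MeasurableSet (IA.toSystem.satEvent (U := Act) Ψ) :=
    (measurable_pi_lambda _ fun t => IA.toSystem.measurable_label.comp
      (measurable_pi_apply t).fst) hΨ.measurableSet
  have hevent : κ.abstractPath cell ⁻¹' IA.toSystem.satEvent Ψ = XU.satEvent (U := U) Ψ := by
    ext ω
    change (fun t => IA.toSystem.label (cell (ω t).1)) ∈ Ψ ↔ _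
    simp only [hlabel]
    rfl
  unfold ControlledMarkovSystem.Satisfies at hsat ⊢
  rwa [← hevent, ← map_measureReal_apply (κ.measurable_abstractPath hcell) hmeas]
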